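/- Consider $N$ sporadic tasks $\tau_1,\dots,\tau_N$ with arbitrary relative deadlines on $M\ge 2$ identical processors under global fixed-priority preemptive scheduling, where $\tau_i$ has higher priority than $\tau_j$ if $i<j$. Task $\tau_i$ has worst-case execution time $C_i>0$, relative deadline $D_i>0$ and minimum inter-arrival time $T_i>0$, with $C_i/D_i\le 1$ and $U_i:=C_i/T_i\le 1$. At each instant the (at most) $M$ ready jobs of highest priority are executed; the jobs of one task are executed sequentially, in order of arrival. A task is schedulable if, for every admissible job sequence of the task set, all jobs of this task finish by their absolute deadlines. Fix $k$ and suppose that $\tau_1,\dots,\tau_{k-1}$ are schedulable. For an integer $\ell\ge 1$ put $D_k'=(\ell-1)T_k+D_k$. Suppose that for every integer $\ell\ge 1$ there is a real $\rho$ with $\ell C_k/D_k'\le\rho\le 1$ such that $$\frac{\ell C_k}{D_k'}+\sum_{\tau_i\in\mathbf T^{\mathrm{carry\text{-}approx}}}\frac{\gamma_iU_iD_i}{D_k'}+\sum_{i=1}^{k-1}\left(\frac{C_i-C_iU_i}{D_k'}+U_i\right)\le\mu_k,\qquad \mu_k:=M-(M-1)\rho,$$ where $\gamma_i=1$ if $U_i>\rho$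 and $\gamma_i=0$ if $U_i\le\rho$, and $\mathbf T^{\mathrm{carry\text{-}approx}}$ is the set of the $\lceil\mu_k\rceil-1$ tasks among $\tau_1,\dots,\tau_{k-1}$ with the largest values of $\gamma_iU_iD_i$ (if fewer than $\lceil\mu_k\rceil-1$ of these tasks have $U_i>\rho$, it is the set of all those that do). Then $\tau_k$ is schedulable. If $D_k\le T_k$, it suffices that this condition holds for $\ell=1$. -/

import Mathlib

open MeasureTheory

noncomputable section

/-- A sporadic task: worst-case execution time `C`, relative deadline `D`, minimum inter-arrival
time `T`, all positive, with `C / D ≤ 1` and utilization `C / T ≤ 1`.  No relation between `D`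
and `T` is imposed (arbitrary deadlines). -/
structure SporadicTask where
  C : ℝ
  D : ℝ
  T : ℝ
  C_pos : 0 < C
  D_pos : 0 < D
  T_pos : 0 < T
  C_le_D : C / D ≤ 1
  C_le_T : C / T ≤ 1

namespace SporadicTask

/-- Utilization `U = C / T`. -/
def U (a : SporadicTask) : ℝ := a.C / a.T

end SporadicTask

/-- A job sequence of the task set `τ`: `arr i j` is the arrival time and `cost i j` the actual
execution time of the `j`-th job (`j = 0, 1, …`) of task `i`.  The system starts at time `0`,
consecutive arrivals of one task are at least `T` apart, and no job runs longer than `C`. -/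
structure JobSequence {N : ℕ} (τ : Fin N → SporadicTask) where
  arr : Fin N → ℕ → ℝ
  cost : Fin N → ℕ → ℝ
  arr_nonneg : ∀ i j, 0 ≤ arr i j
  arr_sep : ∀ i j, arr i j + (τ i).T ≤ arr i (j + 1)
  cost_nonneg : ∀ i j, 0 ≤ cost i j
  cost_le : ∀ i j, cost i j ≤ (τ i).C

namespace JobSequence

variable {N : ℕ} {τ : Fin N → SporadicTask}

/-- The amount of service that job `j` of task `i` has received before time `t`, in the execution
pattern where `exec i j` is the set of time instants at which that job is executed. -/
def service (exec : Fin N → ℕ → Set ℝ) (i : Fin N) (j : ℕ) (t : ℝ) : ℝ :=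
  (volume (exec i j ∩ Set.Ico 0 t)).toReal

/-- Job `j` of task `i` has arrived before or at `t` and has not finished yet at `t`. -/
def Pending (J : JobSequence τ) (exec : Fin N → ℕ → Set ℝ) (i : Fin N) (j : ℕ) (t : ℝ) : Prop :=
  J.arr i j ≤ t ∧ service exec i j t < J.cost i j

/-- Task `i` is active at `t`: at least one of its jobs is pending. -/
def Active (J : JobSequence τ) (exec : Fin N → ℕ → Set ℝ) (i : Fin N) (t : ℝ) : Prop :=
  ∃ j, J.Pending exec i j t

/-- `exec` is the schedule of the jobs `J` on `M` identical unit-speed processors under global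
fixed-priority preemptive scheduling, a smaller task index meaning a higher priority.  The jobs of
one task are served sequentially and in order of arrival, so the ready queue holds the earliest
pending job of every active task; at each instant exactly the `M` ready jobs of highest priority
(all of them, if there are fewer than `M`) are executed.  Jobs migrate freely between processors,
so that only the set of executed jobs matters. -/
structure IsGlobalFPSchedule (J : JobSequence τ) (M : ℕ) (exec : Fin N → ℕ → Set ℝ) : Prop where
  measurable : ∀ i j, MeasurableSet (exec i j)
  exec_iff : ∀ i j t, t ∈ exec i j ↔
    J.Pending exec i j t ∧ (∀ j' < j, ¬ J.Pending exec i j' t) ∧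
      {i' : Fin N | i' < i ∧ J.Active exec i' t}.ncard < M

/-- Job `j` of task `i` has finished by its absolute deadline. -/
def MeetsDeadline (J : JobSequence τ) (exec : Fin N → ℕ → Set ℝ) (i : Fin N) (j : ℕ) : Prop :=
  J.cost i j ≤ service exec i j (J.arr i j + (τ i).D)

end JobSequence

/-- Task `i` of the task set `τ` is schedulable by global fixed-priority preemptive scheduling on
`M` processors: whatever job sequence the tasks release, every job of task `i` meets its deadline
(the worst-case response time of task `i` is at most its relative deadline). -/
def Schedulable {N : ℕ} (M : ℕ) (τ : Fin N → SporadicTask) (i : Fin N) : Prop :=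
  ∀ (J : JobSequence τ) (exec : Fin N → ℕ → Set ℝ), J.IsGlobalFPSchedule M exec →
    ∀ j, J.MeetsDeadline exec i j

/-- `μ = M - (M - 1) ρ`. -/
def muVal (M : ℕ) (ρ : ℝ) : ℝ := (M : ℝ) - ((M : ℝ) - 1) * ρ

open Classical in
/-- `γ = 1` if `U > ρ`, and `γ = 0` if `U ≤ ρ`. -/
def gammaVal (a : SporadicTask) (ρ : ℝ) : ℝ := if ρ < a.U then 1 else 0

/-- `D' = (ℓ - 1) T + D`. -/
def dPrime (a : SporadicTask) (ℓ : ℕ) : ℝ := ((ℓ : ℝ) - 1) * a.T + a.D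

/-- `S` consists of `⌈μ⌉ - 1` tasks among the tasks of higher priority than `k` with the largest
values of `γ U D`; if there are fewer than `⌈μ⌉ - 1` tasks with `U > ρ` (those with `γ ≠ 0`), then
`S` consists of all of these.  Ties are broken arbitrarily. -/
structure IsCarryApprox {N : ℕ} (M : ℕ) (τ : Fin N → SporadicTask) (k : Fin N) (ρ : ℝ)
    (S : Finset (Fin N)) : Prop where
  subset : ∀ i ∈ S, i < k ∧ ρ < (τ i).U
  card_eq : S.card = min (⌈muVal M ρ⌉₊ - 1) {i : Fin N | i < k ∧ ρ < (τ i).U}.ncard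
  largest : ∀ i ∈ S, ∀ j < k, j ∉ S →
    gammaVal (τ j) ρ * (τ j).U * (τ j).D ≤ gammaVal (τ i) ρ * (τ i).U * (τ i).D

end

/-!
Suppose that a job of `τ_k` misses its deadline at `b`, and let `a` be the start of the busy period
of `τ_k` that contains it. While `τ_k` is active but not executed, all `M` processors serve tasks of
higher priority; as `τ_k` is executed for less than `ρ (b - a)`, those tasks and `τ_k` together load
`[a, b)` by at least `μ (b - a)`. Extend the window to the left as long as possible: for the least
`s ≤ a` such that the work of the higher-priority tasks in `[s, b)` and of `τ_k` in `[a, b)` is at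
least `μ (b - s)`, every window that ends at `s` has load below `μ`.

Hence fewer than `μ` tasks carry work in at `s`, as otherwise at least `μ` processors would be busy
just before `s`. A carry-in task with `U ≤ ρ` costs nothing extra: the busy period that it is in at
`s` started at some `p < s`, and a load below `μ = M - (M - 1) ρ` on `[p, s)` means that more than a
fraction `ρ ≥ U` of `[p, s)` went to this task. A carry-in task with `U > ρ` costs at most `U D`
extra, since it meets its deadlines. These bounds on the work in `[s, b)` contradict the test.
-/

theorem continuous_volume_real_inter {A : ℝ → Set ℝ} (hA : ∀ s t, A s ⊆ A t ∪ Set.uIcc s t)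
    (hfin : ∀ t, volume (A t) ≠ ⊤) (E : Set ℝ) : Continuous fun t => volume.real (E ∩ A t) := by
  refine (LipschitzWith.of_le_add fun s t => ?_).continuous
  have hsub : E ∩ A s ⊆ E ∩ A t ∪ Set.uIcc s t := fun u hu =>
    (hA s t hu.2).imp (fun h => ⟨hu.1, h⟩) id
  have hne : volume (E ∩ A t ∪ Set.uIcc s t) ≠ ⊤ :=
    measure_union_ne_top (measure_ne_top_of_subset Set.inter_subset_right (hfin t))
      isCompact_uIcc.measure_ne_top
  calc volume.real (E ∩ A s) ≤ volume.real (E ∩ A t ∪ Set.uIcc s t) := measureReal_mono hsub hne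
    _ ≤ volume.real (E ∩ A t) + volume.real (Set.uIcc s t) := measureReal_union_le _ _
    _ = volume.real (E ∩ A t) + dist s t := by
      rw [Real.volume_real_interval, dist_comm, Real.dist_eq]

theorem volume_inter_Ico_ne_top (E : Set ℝ) (a b : ℝ) : volume (E ∩ Set.Ico a b) ≠ ⊤ :=
  measure_ne_top_of_subset Set.inter_subset_right measure_Ico_lt_top.ne

theorem mul_measureReal_le_sum {Ω ι : Type*} [MeasurableSpace Ω] {μ : Measure Ω} (A : Finset ι)
    {E : ι → Set Ω} (hE : ∀ i ∈ A, MeasurableSet (E i)) {B : Set Ω} (hB : MeasurableSet B)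
    (hfin : μ B ≠ ⊤) {c : ℝ} (h : ∀ s ∈ B, c ≤ ∑ i ∈ A, (E i).indicator 1 s) :
    c * μ.real B ≤ ∑ i ∈ A, μ.real (E i ∩ B) := by
  have hint : ∀ i ∈ A, IntegrableOn ((E i).indicator (1 : Ω → ℝ)) B μ := fun i hi =>
    (integrableOn_const (C := (1 : ℝ)) hfin).indicator (hE i hi)
  calc c * μ.real B = ∫ _ in B, c ∂μ := by rw [setIntegral_const, smul_eq_mul, mul_comm]
    _ ≤ ∫ s in B, ∑ i ∈ A, (E i).indicator 1 s ∂μ :=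
      setIntegral_mono_on (integrableOn_const hfin) (integrable_finsetSum A hint) hB h
    _ = ∑ i ∈ A, ∫ s in B, (E i).indicator 1 s ∂μ := integral_finsetSum A hint
    _ = ∑ i ∈ A, μ.real (E i ∩ B) := Finset.sum_congr rfl fun i hi => by
      rw [integral_indicator_one (hE i hi), measureReal_restrict_apply (hE i hi)]

theorem exists_isLeast_setOf_le {α β : Type*} [ConditionallyCompleteLinearOrder α]
    [TopologicalSpace α] [OrderTopology α] [LinearOrder β] [TopologicalSpace β]
    [OrderClosedTopology β] {f : α → β} {c : β} (hf : Continuous f)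
    (hbot : ∀ᶠ t in Filter.atBot, f t < c) {a : α} (ha : c ≤ f a) :
    ∃ s, IsLeast {t | c ≤ f t} s := by
  have : Nonempty α := ⟨a⟩
  obtain ⟨l, hl⟩ := Filter.eventually_atBot.1 hbot
  exact ⟨_, (isClosed_le continuous_const hf).isLeast_csInf ⟨a, ha⟩
    ⟨l, fun t ht => le_of_not_ge fun htl => (hl t htl).not_ge ht⟩⟩

theorem min_card_le_card_filter_card_lt {α : Type*} [LinearOrder α] (m : ℕ) (A : Finset α) :
    min m A.card ≤ {a ∈ A | {a' ∈ A | a' < a}.card < m}.card := by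
  induction A using Finset.induction_on_max with
  | empty => simp
  | insert a A hmax ih =>
    have ha : a ∉ A := fun h => lt_irrefl a (hmax a h)
    have hbelow : {a' ∈ insert a A | a' < a} = A := by
      rw [Finset.filter_insert, if_neg (lt_irrefl a), Finset.filter_true_of_mem hmax]
    have hbelow' : ∀ b ∈ A, {a' ∈ insert a A | a' < b} = {a' ∈ A | a' < b} := fun b hb => by
      rw [Finset.filter_insert, if_neg (hmax b hb).not_gt]
    have hfilter : {b ∈ A | {a' ∈ insert a A | a' < b}.card < m} =
        {b ∈ A | {a' ∈ A | a' < b}.card < m} :=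
      Finset.filter_congr fun b hb => by rw [hbelow' b hb]
    rw [Finset.filter_insert, hbelow, hfilter, Finset.card_insert_of_notMem ha]
    split_ifs with hm
    · rw [Finset.card_insert_of_notMem fun h => ha (Finset.mem_filter.1 h).1]
      omega
    · omega

theorem sum_le_sum_of_largest {ι R : Type*} [AddCommMonoid R] [LinearOrder R]
    [IsOrderedAddMonoid R] {g : ι → R} {Q S : Finset ι} (hcard : Q.card ≤ S.card)
    (hg : ∀ i ∈ S, 0 ≤ g i) (hS : ∀ i ∈ S, ∀ j ∈ Q, j ∉ S → g j ≤ g i) :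
    ∑ i ∈ Q, g i ≤ ∑ i ∈ S, g i := by
  classical
  have hsdiff : (Q \ S).card ≤ (S \ Q).card := Finset.card_sdiff_le_card_sdiff_iff.2 hcard
  rw [← Finset.sum_inter_add_sum_sdiff Q S g, ← Finset.sum_inter_add_sum_sdiff S Q g,
    Finset.inter_comm S Q]
  gcongr 1
  rcases (S \ Q).eq_empty_or_nonempty with hempty | hne
  · rw [hempty, Finset.card_empty, Nat.le_zero, Finset.card_eq_zero] at hsdiff
    rw [hempty, hsdiff]
  · obtain ⟨m, hm, hmin⟩ := Finset.exists_min_image (S \ Q) g hne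
    have hmS := (Finset.mem_sdiff.1 hm).1
    calc ∑ i ∈ Q \ S, g i ≤ (Q \ S).card • g m :=
          Finset.sum_le_card_nsmul _ _ _ fun j hj =>
            hS m hmS j (Finset.mem_sdiff.1 hj).1 (Finset.mem_sdiff.1 hj).2
      _ ≤ (S \ Q).card • g m := nsmul_le_nsmul_left (hg m hmS) hsdiff
      _ ≤ ∑ i ∈ S \ Q, g i := Finset.card_nsmul_le_sum _ _ _ hmin

namespace SporadicTask

theorem U_pos (a : SporadicTask) : 0 < a.U := div_pos a.C_pos a.T_pos

theorem U_le_one (a : SporadicTask) : a.U ≤ 1 := a.C_le_T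

theorem C_mul_U_le_C (a : SporadicTask) : a.C * a.U ≤ a.C :=
  mul_le_of_le_one_right a.C_pos.le a.U_le_one

theorem U_mul_T (a : SporadicTask) : a.U * a.T = a.C := div_mul_cancel₀ _ a.T_pos.ne'

/-- The linear bound `U t + C (1 - U)` on the execution in a window of length `t` of a task that
has no unfinished job at the start of the window. -/
noncomputable def loadBound (a : SporadicTask) (t : ℝ) : ℝ := a.U * t + (a.C - a.C * a.U)

theorem loadBound_nonneg (a : SporadicTask) {t : ℝ} (ht : 0 ≤ t) : 0 ≤ a.loadBound t :=
  add_nonneg (mul_nonneg a.U_pos.le ht) (sub_nonneg.2 a.C_mul_U_le_C)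

theorem loadBound_add (a : SporadicTask) (s t : ℝ) :
    a.loadBound (s + t) = a.loadBound s + a.U * t := by
  unfold loadBound; ring

/-- The extra execution `γ U D` that a carry-in job of the task can cause. -/
noncomputable def carryWeight (a : SporadicTask) (ρ : ℝ) : ℝ := gammaVal a ρ * a.U * a.D

theorem carryWeight_of_lt {a : SporadicTask} {ρ : ℝ} (h : ρ < a.U) :
    a.carryWeight ρ = a.U * a.D := by
  rw [carryWeight, gammaVal, if_pos h, one_mul]

theorem carryWeight_of_le {a : SporadicTask} {ρ : ℝ} (h : a.U ≤ ρ) : a.carryWeight ρ = 0 := by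
  rw [carryWeight, gammaVal, if_neg h.not_gt, zero_mul, zero_mul]

theorem carryWeight_nonneg (a : SporadicTask) (ρ : ℝ) : 0 ≤ a.carryWeight ρ := by
  rcases lt_or_ge ρ a.U with h | h
  · exact (carryWeight_of_lt h).symm ▸ (mul_pos a.U_pos a.D_pos).le
  · exact (carryWeight_of_le h).ge

end SporadicTask

section Test

variable {N M : ℕ} {τ : Fin N → SporadicTask} {k : Fin N} {ρ : ℝ}

theorem muVal_le_natCast (hM : 1 ≤ M) (hρ : 0 ≤ ρ) : muVal M ρ ≤ M := by
  have hM' : (1 : ℝ) ≤ M := by exact_mod_cast hM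
  exact sub_le_self _ (mul_nonneg (sub_nonneg.2 hM') hρ)

theorem dPrime_pos (a : SporadicTask) (n : ℕ) : 0 < dPrime a (n + 1) := by
  have := a.T_pos
  have := a.D_pos
  rw [dPrime, Nat.cast_succ, add_sub_cancel_right]
  positivity

theorem IsCarryApprox.sum_carryWeight_le {S : Finset (Fin N)} (hS : IsCarryApprox M τ k ρ S)
    {Q : Finset (Fin N)} (hQk : ∀ i ∈ Q, i < k) (hQ : Q.card < ⌈muVal M ρ⌉₊) :
    ∑ i ∈ Q, (τ i).carryWeight ρ ≤ ∑ i ∈ S, (τ i).carryWeight ρ := by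
  classical
  set R := Q.filter fun i => ρ < (τ i).U
  have hRQ : R ⊆ Q := Finset.filter_subset _ _
  have hcard : R.card ≤ S.card := by
    rw [hS.card_eq, ← Set.ncard_coe_finset R]
    refine le_min ?_ (Set.ncard_le_ncard (fun i hi => ?_) (Set.toFinite _))
    · have := Finset.card_le_card hRQ
      rw [Set.ncard_coe_finset]
      omega
    · exact ⟨hQk i (hRQ hi), (Finset.mem_filter.1 hi).2⟩
  calc ∑ i ∈ Q, (τ i).carryWeight ρ = ∑ i ∈ R, (τ i).carryWeight ρ :=
        (Finset.sum_filter_of_ne fun i _ hi =>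
          lt_of_not_ge fun h => hi (SporadicTask.carryWeight_of_le h)).symm
    _ ≤ ∑ i ∈ S, (τ i).carryWeight ρ :=
        sum_le_sum_of_largest hcard (fun i _ => (τ i).carryWeight_nonneg ρ)
          fun i hi j hj => hS.largest i hi j (hQk j (hRQ hj))

/-- The schedulability test for task `k` with the parameter `ρ` and the set `S` of carry-in tasks,
for jobs of task `k` of total execution time `c` in a window of length `d`; the paper has
`c = ℓ C` and `d = D'`. -/
structure UtilizationTest (M : ℕ) (τ : Fin N → SporadicTask) (k : Fin N) (c d ρ : ℝ)
    (S : Finset (Fin N)) : Prop where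
  le_rho : c / d ≤ ρ
  isCarryApprox : IsCarryApprox M τ k ρ S
  sum_le : c / d + ∑ i ∈ S, gammaVal (τ i) ρ * (τ i).U * (τ i).D / d
    + ∑ i ∈ Finset.Iio k, (((τ i).C - (τ i).C * (τ i).U) / d + (τ i).U) ≤ muVal M ρ

namespace UtilizationTest

variable {c d : ℝ} {S : Finset (Fin N)} (h : UtilizationTest M τ k c d ρ S)
include h

theorem add_sum_loadBound_le (hc : 0 ≤ c) (hd : 0 < d) {t : ℝ} (ht : d ≤ t) :
    c + ∑ i ∈ S, (τ i).carryWeight ρ + ∑ i ∈ Finset.Iio k, (τ i).loadBound t ≤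
      muVal M ρ * t := by
  set G := ∑ i ∈ S, (τ i).carryWeight ρ
  set A := ∑ i ∈ Finset.Iio k, ((τ i).C - (τ i).C * (τ i).U) with hA
  set V := ∑ i ∈ Finset.Iio k, (τ i).U with hV
  have hG0 : 0 ≤ G := Finset.sum_nonneg fun i _ => (τ i).carryWeight_nonneg ρ
  have hA0 : 0 ≤ A := Finset.sum_nonneg fun i _ => sub_nonneg.2 (τ i).C_mul_U_le_C
  have hsum : ∑ i ∈ Finset.Iio k, (τ i).loadBound t = V * t + A := by
    rw [hV, Finset.sum_mul, ← Finset.sum_add_distrib]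
    rfl
  have hdiv : (c + G + A) / d ≤ muVal M ρ - V := by
    have hle : c / d + G / d + (A / d + V) ≤ muVal M ρ := by
      rw [hA, Finset.sum_div, Finset.sum_div, ← Finset.sum_add_distrib]
      exact h.sum_le
    rw [add_div, add_div]
    linarith
  have hslope : 0 ≤ muVal M ρ - V := le_trans (by positivity) hdiv
  calc c + G + ∑ i ∈ Finset.Iio k, (τ i).loadBound t = (c + G + A) + V * t := by rw [hsum]; ring
    _ ≤ (muVal M ρ - V) * d + V * t := by gcongr; exact (div_le_iff₀ hd).1 hdiv
    _ ≤ (muVal M ρ - V) * t + V * t := by gcongr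
    _ = muVal M ρ * t := by ring

theorem rho_pos (hc : 0 < c) (hd : 0 < d) : 0 < ρ := (div_pos hc hd).trans_le h.le_rho

theorem muVal_pos (hc : 0 < c) (hd : 0 < d) : 0 < muVal M ρ := by
  have hG : 0 ≤ ∑ i ∈ S, (τ i).carryWeight ρ :=
    Finset.sum_nonneg fun i _ => (τ i).carryWeight_nonneg ρ
  have hL : 0 ≤ ∑ i ∈ Finset.Iio k, (τ i).loadBound d :=
    Finset.sum_nonneg fun i _ => (τ i).loadBound_nonneg hd.le
  have := h.add_sum_loadBound_le hc.le hd le_rfl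
  exact pos_of_mul_pos_left (by linarith) hd.le

end UtilizationTest

end Test

namespace JobSequence

variable {N : ℕ} {τ : Fin N → SporadicTask}

theorem arr_add_mul_le (J : JobSequence τ) (i : Fin N) (j n : ℕ) :
    J.arr i j + n * (τ i).T ≤ J.arr i (j + n) := by
  induction n with
  | zero => simp
  | succ n ih =>
    have := J.arr_sep i (j + n)
    rw [Nat.cast_succ, add_one_mul, ← add_assoc, ← add_assoc]
    linarith

theorem arr_strictMono (J : JobSequence τ) (i : Fin N) : StrictMono (J.arr i) :=
  strictMono_nat_of_lt_succ fun j => (lt_add_of_pos_right _ (τ i).T_pos).trans_le (J.arr_sep i j)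

theorem tendsto_arr_atTop (J : JobSequence τ) (i : Fin N) :
    Filter.Tendsto (J.arr i) Filter.atTop Filter.atTop := by
  refine Filter.tendsto_atTop_mono (fun n => ?_)
    (tendsto_natCast_atTop_atTop.atTop_mul_const (τ i).T_pos)
  have := J.arr_add_mul_le i 0 n
  rw [zero_add] at this
  linarith [J.arr_nonneg i 0]

/-- The time instants at which task `i` is executed. -/
def taskExec (exec : Fin N → ℕ → Set ℝ) (i : Fin N) : Set ℝ := ⋃ j, exec i j

/-- The amount of execution of task `i` in the time window `[s, t)`. -/
noncomputable def work (exec : Fin N → ℕ → Set ℝ) (i : Fin N) (s t : ℝ) : ℝ :=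
  volume.real (taskExec exec i ∩ Set.Ico s t)

/-- The amount of execution of the tasks of higher priority than `k` in the time window
`[s, t)`. -/
noncomputable def higherWork (exec : Fin N → ℕ → Set ℝ) (k : Fin N) (s t : ℝ) : ℝ :=
  ∑ i ∈ Finset.Iio k, work exec i s t

/-- On every time window that ends at `s`, the tasks of higher priority than `k` load the
processors by less than `μ`. -/
def LoadBelow (exec : Fin N → ℕ → Set ℝ) (k : Fin N) (μ s : ℝ) : Prop :=
  ∀ t < s, higherWork exec k t s < μ * (s - t)

/-- Some job of task `i` that arrived before `s` is unfinished at `s`. -/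
def CarryIn (J : JobSequence τ) (exec : Fin N → ℕ → Set ℝ) (i : Fin N) (s : ℝ) : Prop :=
  ∃ j, J.arr i j < s ∧ service exec i j s < J.cost i j

/-- Job `p` starts a busy period of task `i` that lasts until `t` at least. -/
structure BusyFrom (J : JobSequence τ) (exec : Fin N → ℕ → Set ℝ) (i : Fin N) (p : ℕ) (t : ℝ) :
    Prop where
  active : ∀ s ∈ Set.Ico (J.arr i p) t, J.Active exec i s
  finished : ∀ j < p, J.cost i j ≤ service exec i j (J.arr i p)

open Classical in
/-- The tasks of higher priority than `k` that are executed at `t`. -/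
noncomputable def higherExecuted (exec : Fin N → ℕ → Set ℝ) (k : Fin N) (t : ℝ) :
    Finset (Fin N) := {i ∈ Finset.Iio k | t ∈ taskExec exec i}

open Classical in
/-- The tasks of higher priority than `k` that are active at `t`. -/
noncomputable def higherActive (J : JobSequence τ) (exec : Fin N → ℕ → Set ℝ) (k : Fin N)
    (t : ℝ) : Finset (Fin N) := {i ∈ Finset.Iio k | J.Active exec i t}

open Classical in
/-- The tasks of higher priority than `k` with a carry-in job at `s`. -/
noncomputable def higherCarryIn (J : JobSequence τ) (exec : Fin N → ℕ → Set ℝ) (k : Fin N)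
    (s : ℝ) : Finset (Fin N) := {i ∈ Finset.Iio k | J.CarryIn exec i s}

variable {J : JobSequence τ} {exec : Fin N → ℕ → Set ℝ}

theorem mem_higherExecuted {i k : Fin N} {t : ℝ} :
    i ∈ higherExecuted exec k t ↔ i < k ∧ t ∈ taskExec exec i := by
  simp only [higherExecuted, Finset.mem_filter, Finset.mem_Iio]

theorem mem_higherActive {i k : Fin N} {t : ℝ} :
    i ∈ J.higherActive exec k t ↔ i < k ∧ J.Active exec i t := by
  simp only [higherActive, Finset.mem_filter, Finset.mem_Iio]

theorem mem_higherCarryIn {i k : Fin N} {s : ℝ} :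
    i ∈ J.higherCarryIn exec k s ↔ i < k ∧ J.CarryIn exec i s := by
  simp only [higherCarryIn, Finset.mem_filter, Finset.mem_Iio]

theorem sum_indicator_taskExec (k : Fin N) (t : ℝ) :
    ∑ i ∈ Finset.Iio k, (taskExec exec i).indicator (1 : ℝ → ℝ) t =
      (higherExecuted exec k t).card := by
  classical
  simp only [Set.indicator_apply, Pi.one_apply, Finset.sum_boole, higherExecuted]

theorem service_mono (exec : Fin N → ℕ → Set ℝ) (i : Fin N) (j : ℕ) :
    Monotone (service exec i j) := fun _ _ h =>
  measureReal_mono (Set.inter_subset_inter_right _ (Set.Ico_subset_Ico_right h))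
    (volume_inter_Ico_ne_top _ _ _)

theorem continuous_service (exec : Fin N → ℕ → Set ℝ) (i : Fin N) (j : ℕ) :
    Continuous (service exec i j) := by
  refine continuous_volume_real_inter (fun s t u hu => ?_) (fun _ => measure_Ico_lt_top.ne) _
  exact (lt_or_ge u t).imp (fun h => ⟨hu.1, h⟩) fun h => Set.mem_uIcc_of_ge h hu.2.le

theorem continuous_work_left (exec : Fin N → ℕ → Set ℝ) (i : Fin N) (b : ℝ) :
    Continuous fun a => work exec i a b := by
  refine continuous_volume_real_inter (fun s t u hu => ?_) (fun _ => measure_Ico_lt_top.ne) _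
  exact (le_or_gt t u).imp (fun h => ⟨h, hu.2⟩) fun h => Set.mem_uIcc_of_le hu.1 h.le

theorem work_nonneg (exec : Fin N → ℕ → Set ℝ) (i : Fin N) (s t : ℝ) : 0 ≤ work exec i s t :=
  measureReal_nonneg

theorem higherWork_add_work_le {i k : Fin N} (hik : i < k) (s t : ℝ) :
    higherWork exec i s t + work exec i s t ≤ higherWork exec k s t := by
  unfold higherWork
  rw [add_comm, ← Finset.sum_insert (f := fun a => work exec a s t)
    fun h => lt_irrefl i (Finset.mem_Iio.1 h)]
  refine Finset.sum_le_sum_of_subset_of_nonneg (fun a ha => ?_) fun _ _ _ => work_nonneg _ _ _ _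
  rcases Finset.mem_insert.1 ha with rfl | ha
  · exact Finset.mem_Iio.2 hik
  · exact Finset.mem_Iio.2 ((Finset.mem_Iio.1 ha).trans hik)

theorem pending_of_service_lt {i : Fin N} {j : ℕ} {s t : ℝ}
    (ht : service exec i j t < J.cost i j) (hs : J.arr i j ≤ s) (hst : s ≤ t) :
    J.Pending exec i j s :=
  ⟨hs, (service_mono exec i j hst).trans_lt ht⟩

theorem busyFrom_of_service_lt {i : Fin N} {j : ℕ} {t : ℝ}
    (ht : service exec i j t < J.cost i j)
    (hfin : ∀ j' < j, J.cost i j' ≤ service exec i j' (J.arr i j)) : BusyFrom J exec i j t :=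
  ⟨fun _ hs => ⟨j, pending_of_service_lt ht hs.1 hs.2.le⟩, hfin⟩

theorem exists_busyFrom {i : Fin N} {j : ℕ} {t : ℝ}
    (ht : service exec i j t < J.cost i j) : ∃ p ≤ j, BusyFrom J exec i p t := by
  classical
  have hj : ∀ s ∈ Set.Ico (J.arr i j) t, J.Active exec i s := fun s hs =>
    ⟨j, pending_of_service_lt ht hs.1 hs.2.le⟩
  have hex : ∃ p, ∀ s ∈ Set.Ico (J.arr i p) t, J.Active exec i s := ⟨j, hj⟩
  refine ⟨Nat.find hex, Nat.find_min' hex hj, Nat.find_spec hex, fun q hq => ?_⟩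
  by_contra! hlt
  refine Nat.find_min hex hq fun s hs => ?_
  rcases le_or_gt (J.arr i (Nat.find hex)) s with h | h
  · exact Nat.find_spec hex s ⟨h, hs.2⟩
  · exact ⟨q, pending_of_service_lt hlt hs.1 h.le⟩

theorem CarryIn.eventually_active {i : Fin N} {s : ℝ} (h : J.CarryIn exec i s) :
    ∀ᶠ t in nhdsWithin s (Set.Iio s), J.Active exec i t := by
  obtain ⟨j, hj, hser⟩ := h
  filter_upwards [Ico_mem_nhdsLT hj] with t ht
  exact ⟨j, pending_of_service_lt hser ht.1 ht.2.le⟩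

namespace IsGlobalFPSchedule

variable {M : ℕ} (H : J.IsGlobalFPSchedule M exec)
include H

theorem pending {i : Fin N} {j : ℕ} {t : ℝ} (ht : t ∈ exec i j) : J.Pending exec i j t :=
  ((H.exec_iff i j t).1 ht).1

theorem nonneg_of_mem_taskExec {i : Fin N} {t : ℝ} (ht : t ∈ taskExec exec i) : 0 ≤ t := by
  obtain ⟨j, hj⟩ := Set.mem_iUnion.1 ht
  exact (J.arr_nonneg i j).trans (H.pending hj).1

theorem measurableSet_taskExec (i : Fin N) : MeasurableSet (taskExec exec i) :=
  MeasurableSet.iUnion fun j => H.measurable i j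

theorem work_add_work (i : Fin N) {a b c : ℝ} (hab : a ≤ b) (hbc : b ≤ c) :
    work exec i a b + work exec i b c = work exec i a c := by
  unfold work
  rw [← Set.Ico_union_Ico_eq_Ico hab hbc, Set.inter_union_distrib_left,
    measureReal_union (Set.Ico_disjoint_Ico_same.mono Set.inter_subset_right
      Set.inter_subset_right) ((H.measurableSet_taskExec i).inter measurableSet_Ico)
      (volume_inter_Ico_ne_top _ _ _) (volume_inter_Ico_ne_top _ _ _)]

theorem higherWork_add_higherWork (k : Fin N) {a b c : ℝ} (hab : a ≤ b) (hbc : b ≤ c) :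
    higherWork exec k a b + higherWork exec k b c = higherWork exec k a c := by
  unfold higherWork
  rw [← Finset.sum_add_distrib]
  exact Finset.sum_congr rfl fun i _ => H.work_add_work i hab hbc

theorem higherWork_le_zero_left (k : Fin N) (t b : ℝ) :
    higherWork exec k t b ≤ higherWork exec k 0 b :=
  Finset.sum_le_sum fun _ _ => measureReal_mono
    (fun _ hu => ⟨hu.1, H.nonneg_of_mem_taskExec hu.1, hu.2.2⟩) (volume_inter_Ico_ne_top _ _ _)

theorem lt_of_mem_exec {i : Fin N} {j : ℕ} {s t : ℝ} (hs : J.cost i j ≤ service exec i j s)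
    (ht : t ∈ exec i j) : t < s :=
  lt_of_not_ge fun h => (H.pending ht).2.not_ge (hs.trans (service_mono exec i j h))

theorem service_le_cost (i : Fin N) (j : ℕ) (t : ℝ) : service exec i j t ≤ J.cost i j := by
  by_contra! hlt
  have hzero : service exec i j (min t 0) ≤ J.cost i j := by
    simp [service, J.cost_nonneg]
  obtain ⟨s, -, hs⟩ := intermediate_value_Icc (min_le_left t 0)
    (continuous_service exec i j).continuousOn ⟨hzero, hlt.le⟩
  have hts : service exec i j t ≤ service exec i j s :=
    measureReal_mono (fun u hu => ⟨hu.1, hu.2.1, H.lt_of_mem_exec hs.ge hu.1⟩)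
      (volume_inter_Ico_ne_top _ _ _)
  linarith

theorem service_le_sub_arr {i : Fin N} {j : ℕ} {t : ℝ} (ht : J.arr i j ≤ t) :
    service exec i j t ≤ t - J.arr i j := by
  rw [← Real.volume_real_Ico_of_le ht]
  exact measureReal_mono (fun u hu => ⟨(H.pending hu.1).1, hu.2.2⟩) measure_Ico_lt_top.ne

theorem service_le_C (i : Fin N) (j : ℕ) (t : ℝ) : service exec i j t ≤ (τ i).C :=
  (H.service_le_cost i j t).trans (J.cost_le i j)

theorem service_le_loadBound {i : Fin N} {j : ℕ} {t : ℝ} (ht : J.arr i j ≤ t) :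
    service exec i j t ≤ (τ i).loadBound (t - J.arr i j) := by
  -- a convex combination of the bounds `C` and `t - arr`
  have hC := mul_le_mul_of_nonneg_left (H.service_le_C i j t) (sub_nonneg.2 (τ i).U_le_one)
  have hsub := mul_le_mul_of_nonneg_left (H.service_le_sub_arr ht) (τ i).U_pos.le
  rw [SporadicTask.loadBound]
  linarith

theorem work_le_sum_service {i : Fin N} {p q : ℕ} {s t : ℝ}
    (hp : ∀ j < p, J.cost i j ≤ service exec i j s)
    (hq : ∀ j ≥ q, ∀ u < t, u ∉ exec i j) :
    work exec i s t ≤ ∑ j ∈ Finset.Ico p q, service exec i j t := by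
  have hsub : taskExec exec i ∩ Set.Ico s t ⊆
      ⋃ j ∈ Finset.Ico p q, exec i j ∩ Set.Ico 0 t := by
    rintro u ⟨hu, hsu, hut⟩
    have hu0 := H.nonneg_of_mem_taskExec hu
    obtain ⟨j, hj⟩ := Set.mem_iUnion.1 hu
    have hpj : p ≤ j := le_of_not_gt fun h => (H.lt_of_mem_exec (hp j h) hj).not_ge hsu
    have hjq : j < q := lt_of_not_ge fun h => hq j h u hut hj
    exact Set.mem_biUnion (Finset.mem_Ico.2 ⟨hpj, hjq⟩) ⟨hj, hu0, hut⟩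
  have hne : volume (⋃ j ∈ Finset.Ico p q, exec i j ∩ Set.Ico 0 t) ≠ ⊤ :=
    measure_ne_top_of_subset (Set.iUnion₂_subset fun _ _ => Set.inter_subset_right)
      measure_Ico_lt_top.ne
  exact (measureReal_mono hsub hne).trans (measureReal_biUnion_finset_le _ _)

theorem work_le_loadBound {i : Fin N} {p : ℕ} {a s t : ℝ} (hap : a ≤ J.arr i p) (hat : a ≤ t)
    (hp : ∀ j < p, J.cost i j ≤ service exec i j s) :
    work exec i s t ≤ (τ i).loadBound (t - a) := by
  have hnot_exec : ∀ q, t ≤ J.arr i q → ∀ j ≥ q, ∀ u < t, u ∉ exec i j := fun q hq j hj u hut hu =>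
    (hut.trans_le (hq.trans ((J.arr_strictMono i).monotone hj))).not_ge (H.pending hu).1
  rcases le_or_gt t (J.arr i p) with htp | hpt
  · have hwork := H.work_le_sum_service hp (hnot_exec p htp)
    rw [Finset.Ico_self, Finset.sum_empty] at hwork
    exact hwork.trans ((τ i).loadBound_nonneg (sub_nonneg.2 hat))
  obtain ⟨q, hqt, htq⟩ := (J.arr_strictMono i).exists_between_of_tendsto_atTop
    (J.tendsto_arr_atTop i) (((J.arr_strictMono i).monotone p.zero_le).trans_lt hpt)
  obtain ⟨n, rfl⟩ := Nat.exists_eq_add_of_le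
    (Nat.lt_succ_iff.1 ((J.arr_strictMono i).lt_iff_lt.1 (hpt.trans_le htq)))
  have hearlier : ∑ j ∈ Finset.Ico p (p + n), service exec i j t ≤
      (τ i).U * (J.arr i (p + n) - a) := by
    calc _ ≤ n * (τ i).C := by
          simpa using Finset.sum_le_card_nsmul (Finset.Ico p (p + n)) _ _ fun j _ =>
            H.service_le_C i j t
      _ = (τ i).U * (n * (τ i).T) := by rw [← (τ i).U_mul_T]; ring
      _ ≤ (τ i).U * (J.arr i (p + n) - a) :=
        mul_le_mul_of_nonneg_left (by linarith [J.arr_add_mul_le i p n]) (τ i).U_pos.le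
  calc work exec i s t
      ≤ ∑ j ∈ Finset.Ico p (p + n), service exec i j t + service exec i (p + n) t := by
        rw [← Finset.sum_Ico_succ_top (Nat.le_add_right p n)]
        exact H.work_le_sum_service hp (hnot_exec _ htq)
    _ ≤ (τ i).U * (J.arr i (p + n) - a) + (τ i).loadBound (t - J.arr i (p + n)) :=
        add_le_add hearlier (H.service_le_loadBound hqt.le)
    _ = (τ i).loadBound (t - a) := by
        rw [add_comm, ← SporadicTask.loadBound_add, sub_add_sub_cancel]

theorem work_le_loadBound_of_finished {i : Fin N} {s t x : ℝ} (hx : 0 ≤ x) (hst : s ≤ t)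
    (h : ∀ j, J.arr i j + x < s → J.cost i j ≤ service exec i j s) :
    work exec i s t ≤ (τ i).loadBound (t - s + x) := by
  classical
  have hex : ∃ p, s - x ≤ J.arr i p := ((J.tendsto_arr_atTop i).eventually_ge_atTop _).exists
  rw [show t - s + x = t - (s - x) by ring]
  exact H.work_le_loadBound (Nat.find_spec hex) (by linarith) fun j hj =>
    h j (by linarith [Nat.find_min hex hj])

theorem work_le_of_not_carryIn {i : Fin N} {s t : ℝ} (hst : s ≤ t) (h : ¬ J.CarryIn exec i s) :
    work exec i s t ≤ (τ i).loadBound (t - s) := by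
  have := H.work_le_loadBound_of_finished le_rfl hst fun j hj =>
    le_of_not_gt fun hlt => h ⟨j, by rwa [add_zero] at hj, hlt⟩
  rwa [add_zero] at this

theorem work_le_of_meetsDeadline {i : Fin N} {s t : ℝ} (hst : s ≤ t)
    (hdl : ∀ j, J.MeetsDeadline exec i j) :
    work exec i s t ≤ (τ i).loadBound (t - s) + (τ i).U * (τ i).D := by
  rw [← SporadicTask.loadBound_add]
  exact H.work_le_loadBound_of_finished (τ i).D_pos.le hst fun j hj =>
    (hdl j).trans (service_mono exec i j hj.le)

theorem work_le_of_busyFrom {i : Fin N} {p : ℕ} {s t : ℝ} (hps : J.arr i p ≤ s) (hst : s ≤ t)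
    (hbusy : BusyFrom J exec i p s)
    (hwork : (τ i).U * (s - J.arr i p) ≤ work exec i (J.arr i p) s) :
    work exec i s t ≤ (τ i).loadBound (t - s) := by
  have htotal := H.work_le_loadBound le_rfl (hps.trans hst) hbusy.finished
  rw [← H.work_add_work i hps hst, ← sub_add_sub_cancel t s, SporadicTask.loadBound_add] at htotal
  linarith

theorem mem_taskExec {i : Fin N} {t : ℝ} (hi : J.Active exec i t)
    (hM : (J.higherActive exec i t).card < M) : t ∈ taskExec exec i := by
  classical
  have hset : {i' : Fin N | i' < i ∧ J.Active exec i' t} = J.higherActive exec i t := by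
    ext i'
    exact mem_higherActive.symm
  refine Set.mem_iUnion.2 ⟨Nat.find hi, (H.exec_iff i _ t).2
    ⟨Nat.find_spec hi, fun j hj => Nat.find_min hi hj, ?_⟩⟩
  rwa [hset, Set.ncard_coe_finset]

theorem min_card_higherActive_le (k : Fin N) (t : ℝ) :
    min M (J.higherActive exec k t).card ≤ (higherExecuted exec k t).card := by
  refine (min_card_le_card_filter_card_lt M (J.higherActive exec k t)).trans
    (Finset.card_le_card fun i hi => ?_)
  obtain ⟨hik, hcard⟩ := Finset.mem_filter.1 hi
  obtain ⟨hik, hact⟩ := mem_higherActive.1 hik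
  refine mem_higherExecuted.2 ⟨hik, H.mem_taskExec hact (lt_of_le_of_lt ?_ hcard)⟩
  refine Finset.card_le_card fun i' hi' => ?_
  obtain ⟨hi'i, hact'⟩ := mem_higherActive.1 hi'
  exact Finset.mem_filter.2 ⟨mem_higherActive.2 ⟨hi'i.trans hik, hact'⟩, hi'i⟩

theorem mul_volume_real_le_higherWork {k : Fin N} {a b c : ℝ} {B : Set ℝ} (hB : MeasurableSet B)
    (hsub : B ⊆ Set.Ico a b) (hc : ∀ t ∈ B, c ≤ (higherExecuted exec k t).card) :
    c * volume.real B ≤ higherWork exec k a b := by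
  calc c * volume.real B ≤ ∑ i ∈ Finset.Iio k, volume.real (taskExec exec i ∩ B) :=
        mul_measureReal_le_sum _ (fun i _ => H.measurableSet_taskExec i) hB
          (measure_ne_top_of_subset hsub measure_Ico_lt_top.ne) fun t ht =>
            (hc t ht).trans_eq (sum_indicator_taskExec k t).symm
    _ ≤ higherWork exec k a b := Finset.sum_le_sum fun _ _ =>
        measureReal_mono (Set.inter_subset_inter_right _ hsub) (volume_inter_Ico_ne_top _ _ _)

theorem mul_sub_work_le_higherWork {i : Fin N} {a b : ℝ} (hab : a ≤ b)
    (hact : ∀ t ∈ Set.Ico a b, J.Active exec i t) :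
    M * (b - a - work exec i a b) ≤ higherWork exec i a b := by
  have hvol : volume.real (Set.Ico a b \ taskExec exec i) = b - a - work exec i a b := by
    rw [eq_sub_iff_add_eq, work, Set.inter_comm,
      measureReal_sdiff_add_inter (H.measurableSet_taskExec i) measure_Ico_lt_top.ne,
      Real.volume_real_Ico_of_le hab]
  rw [← hvol]
  refine H.mul_volume_real_le_higherWork (measurableSet_Ico.diff (H.measurableSet_taskExec i))
    Set.sdiff_subset fun t ht => ?_
  have hM : M ≤ (J.higherActive exec i t).card :=
    le_of_not_gt fun h => ht.2 (H.mem_taskExec (hact t ht.1) h)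
  exact_mod_cast (le_min le_rfl hM).trans (H.min_card_higherActive_le i t)

theorem card_higherCarryIn_lt {k : Fin N} {μ s : ℝ} (hμ : μ ≤ M)
    (hs : LoadBelow exec k μ s) : ((J.higherCarryIn exec k s).card : ℝ) < μ := by
  set Q := J.higherCarryIn exec k s
  have hev : ∀ᶠ t in nhdsWithin s (Set.Iio s), ∀ i ∈ Q, J.Active exec i t :=
    (Filter.eventually_all_finset Q).2 fun i hi => (mem_higherCarryIn.1 hi).2.eventually_active
  obtain ⟨t, hts, hact⟩ := (mem_nhdsLT_iff_exists_Ico_subset (s := {t | _})).1 hev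
  have hexec : ∀ u ∈ Set.Ico t s, ((min M Q.card : ℕ) : ℝ) ≤ (higherExecuted exec k u).card := by
    intro u hu
    have hQ : Q ⊆ J.higherActive exec k u := fun i hi =>
      mem_higherActive.2 ⟨(mem_higherCarryIn.1 hi).1, hact hu i hi⟩
    exact_mod_cast (min_le_min_left M (Finset.card_le_card hQ)).trans
      (H.min_card_higherActive_le k u)
  have hwork := H.mul_volume_real_le_higherWork measurableSet_Ico subset_rfl hexec
  rw [Real.volume_real_Ico_of_le hts.le] at hwork
  have hlt : ((min M Q.card : ℕ) : ℝ) < μ :=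
    lt_of_mul_lt_mul_right (hwork.trans_lt (hs t hts)) (sub_nonneg.2 hts.le)
  rw [Nat.cast_min] at hlt
  exact (min_lt_iff.1 hlt).resolve_left hμ.not_gt

theorem exists_loadBelow {k : Fin N} {μ a b x : ℝ} (hμ : 0 < μ)
    (h : μ * (b - a) ≤ higherWork exec k a b + x) (hab : a ≤ b) :
    ∃ s ≤ a, μ * (b - s) ≤ higherWork exec k s b + x ∧ LoadBelow exec k μ s := by
  set f : ℝ → ℝ := fun t => higherWork exec k t b - μ * (b - t) with hf
  have hcont : Continuous f :=
    (continuous_finsetSum _ fun i _ => continuous_work_left exec i b).sub (by fun_prop)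
  have hbot : ∀ᶠ t in Filter.atBot, f t < -x := by
    filter_upwards [Filter.eventually_lt_atBot (b - (higherWork exec k 0 b + x) / μ)] with t ht
    have hlt : higherWork exec k 0 b + x < (b - t) * μ := (div_lt_iff₀ hμ).1 (by linarith)
    have := H.higherWork_le_zero_left k t b
    simp only [hf]
    linarith
  have hfa : -x ≤ f a := by simp only [hf]; linarith
  obtain ⟨s, hfs : -x ≤ f s, hleast⟩ := exists_isLeast_setOf_le hcont hbot hfa
  have hsa : s ≤ a := hleast hfa
  refine ⟨s, hsa, by simp only [hf] at hfs; linarith, fun t hts => ?_⟩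
  have hft : f t < -x := lt_of_not_ge fun h => hts.not_ge (hleast h)
  simp only [hf, ← H.higherWork_add_higherWork k hts.le (hsa.trans hab)] at hft
  linarith

theorem work_le_of_loadBelow {i k : Fin N} {ρ s t : ℝ} (hM : 1 ≤ M) (hik : i < k)
    (hU : (τ i).U ≤ ρ) (hs : LoadBelow exec k (muVal M ρ) s) (hst : s ≤ t)
    (hi : J.CarryIn exec i s) : work exec i s t ≤ (τ i).loadBound (t - s) := by
  obtain ⟨j, hjs, hj⟩ := hi
  obtain ⟨p, hpj, hbusy⟩ := exists_busyFrom hj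
  set a := J.arr i p
  have has : a < s := ((J.arr_strictMono i).monotone hpj).trans_lt hjs
  have hidle := H.mul_sub_work_le_higherWork has.le hbusy.active
  have hload : higherWork exec i a s + work exec i a s < muVal M ρ * (s - a) :=
    (higherWork_add_work_le hik a s).trans_lt (hs a has)
  have hρ : ρ * (s - a) ≤ work exec i a s := by
    have hM' : (1 : ℝ) ≤ M := by exact_mod_cast hM
    refine (lt_of_mul_lt_mul_left (?_ : ((M : ℝ) - 1) * _ < (M - 1) * _) (by linarith)).le
    unfold muVal at hload
    linarith
  exact H.work_le_of_busyFrom has.le hst hbusy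
    ((mul_le_mul_of_nonneg_right hU (sub_nonneg.2 has.le)).trans hρ)

theorem work_le_of_carryIn {i k : Fin N} {ρ s t : ℝ} (hM : 1 ≤ M) (hik : i < k)
    (hdl : ρ < (τ i).U → ∀ j, J.MeetsDeadline exec i j)
    (hs : LoadBelow exec k (muVal M ρ) s) (hst : s ≤ t) (hi : J.CarryIn exec i s) :
    work exec i s t ≤ (τ i).loadBound (t - s) + (τ i).carryWeight ρ := by
  rcases lt_or_ge ρ (τ i).U with hU | hU
  · rw [SporadicTask.carryWeight_of_lt hU]
    exact H.work_le_of_meetsDeadline hst (hdl hU)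
  · rw [SporadicTask.carryWeight_of_le hU, add_zero]
    exact H.work_le_of_loadBelow hM hik hU hs hst hi

theorem higherWork_le {k : Fin N} {ρ s t : ℝ} {S : Finset (Fin N)} (hM : 1 ≤ M) (hρ : 0 ≤ ρ)
    (hS : IsCarryApprox M τ k ρ S)
    (hdl : ∀ i < k, ρ < (τ i).U → ∀ j, J.MeetsDeadline exec i j)
    (hs : LoadBelow exec k (muVal M ρ) s) (hst : s ≤ t) :
    higherWork exec k s t ≤
      ∑ i ∈ S, (τ i).carryWeight ρ + ∑ i ∈ Finset.Iio k, (τ i).loadBound (t - s) := by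
  classical
  set Q := J.higherCarryIn exec k s
  have hwork : ∀ i ∈ Finset.Iio k, work exec i s t ≤
      (τ i).loadBound (t - s) + if i ∈ Q then (τ i).carryWeight ρ else 0 := by
    intro i hi
    have hik := Finset.mem_Iio.1 hi
    split_ifs with hiQ
    · exact H.work_le_of_carryIn hM hik (hdl i hik) hs hst (mem_higherCarryIn.1 hiQ).2
    · rw [add_zero]
      exact H.work_le_of_not_carryIn hst fun h => hiQ (mem_higherCarryIn.2 ⟨hik, h⟩)
  have hQk : ∀ i ∈ Q, i < k := fun i hi => (mem_higherCarryIn.1 hi).1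
  have hfilter : (Finset.Iio k).filter (· ∈ Q) = Q := by
    rw [Finset.filter_mem_eq_inter]
    exact Finset.inter_eq_right.2 fun i hi => Finset.mem_Iio.2 (hQk i hi)
  calc higherWork exec k s t
      ≤ ∑ i ∈ Finset.Iio k, ((τ i).loadBound (t - s) +
          if i ∈ Q then (τ i).carryWeight ρ else 0) := Finset.sum_le_sum hwork
    _ = ∑ i ∈ Q, (τ i).carryWeight ρ + ∑ i ∈ Finset.Iio k, (τ i).loadBound (t - s) := by
        rw [Finset.sum_add_distrib, ← Finset.sum_filter, hfilter, add_comm]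
    _ ≤ _ := by
        gcongr 1
        exact hS.sum_carryWeight_le hQk
          (Nat.lt_ceil.2 (H.card_higherCarryIn_lt (muVal_le_natCast hM hρ) hs))

theorem work_lt_of_busyFrom {k : Fin N} {p n : ℕ} {t : ℝ} (hbusy : BusyFrom J exec k p t)
    (hlt : service exec k (p + n) t < J.cost k (p + n)) :
    work exec k (J.arr k p) t < (n + 1 : ℕ) * (τ k).C := by
  have hblocked : ∀ j ≥ p + n + 1, ∀ u < t, u ∉ exec k j := by
    intro j hj u hut hu
    refine ((H.exec_iff k j u).1 hu).2.1 (p + n) (by omega)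
      (pending_of_service_lt hlt ?_ hut.le)
    exact ((J.arr_strictMono k).monotone (by omega)).trans (H.pending hu).1
  calc work exec k (J.arr k p) t ≤ ∑ j ∈ Finset.Ico p (p + n + 1), service exec k j t :=
        H.work_le_sum_service hbusy.finished hblocked
    _ < ∑ _j ∈ Finset.Ico p (p + n + 1), (τ k).C :=
        Finset.sum_lt_sum (fun j _ => H.service_le_C k j t)
          ⟨p + n, by simp, hlt.trans_le (J.cost_le k _)⟩
    _ = (n + 1 : ℕ) * (τ k).C := by
        rw [Finset.sum_const, Nat.card_Ico, nsmul_eq_mul, add_assoc, Nat.add_sub_cancel_left]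

theorem not_busyFrom {k : Fin N} {p : ℕ} {b c d ρ : ℝ} {S : Finset (Fin N)} (hM : 1 ≤ M)
    (htest : UtilizationTest M τ k c d ρ S)
    (hdl : ∀ i < k, ρ < (τ i).U → ∀ j, J.MeetsDeadline exec i j) (hd : 0 < d)
    (hdb : d ≤ b - J.arr k p) (hwork : work exec k (J.arr k p) b < c) :
    ¬ BusyFrom J exec k p b := by
  intro hbusy
  set a := J.arr k p
  set x := work exec k a b
  have hc : 0 < c := (work_nonneg exec k a b).trans_lt hwork
  have hab : a ≤ b := by linarith
  have hρ := htest.rho_pos hc hd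
  have hM' : (1 : ℝ) ≤ M := by exact_mod_cast hM
  have hx : x ≤ ρ * (b - a) :=
    hwork.le.trans (((div_le_iff₀ hd).1 htest.le_rho).trans (by gcongr))
  have hload : muVal M ρ * (b - a) ≤ higherWork exec k a b + x := by
    have hidle : M * (b - a - x) ≤ higherWork exec k a b :=
      H.mul_sub_work_le_higherWork hab hbusy.active
    have := mul_le_mul_of_nonneg_left hx (sub_nonneg.2 hM')
    unfold muVal
    linarith
  obtain ⟨s, hsa, hsload, hs⟩ := H.exists_loadBelow (htest.muVal_pos hc hd) hload hab
  have hhigher := H.higherWork_le hM hρ.le htest.isCarryApprox hdl hs (hsa.trans hab)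
  have := htest.add_sum_loadBound_le hc.le hd (t := b - s) (by linarith)
  linarith

theorem meetsDeadline_of_busyFrom {k : Fin N} {p n : ℕ} {ρ : ℝ} {S : Finset (Fin N)} (hM : 1 ≤ M)
    (htest : UtilizationTest M τ k ((n + 1 : ℕ) * (τ k).C) (dPrime (τ k) (n + 1)) ρ S)
    (hdl : ∀ i < k, ρ < (τ i).U → ∀ j, J.MeetsDeadline exec i j)
    (hbusy : BusyFrom J exec k p (J.arr k (p + n) + (τ k).D)) :
    J.MeetsDeadline exec k (p + n) := by
  by_contra hmiss
  refine H.not_busyFrom hM htest hdl (dPrime_pos _ n) ?_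
    (H.work_lt_of_busyFrom hbusy (not_le.1 hmiss)) hbusy
  rw [dPrime, Nat.cast_succ, add_sub_cancel_right]
  linarith [J.arr_add_mul_le k p n]

end IsGlobalFPSchedule

end JobSequence

theorem schedulable_of_utilizationTest {N M : ℕ} {τ : Fin N → SporadicTask} {k : Fin N}
    (hM : 1 ≤ M)
    (h : ∀ ℓ : ℕ, 1 ≤ ℓ → ∃ ρ S, UtilizationTest M τ k (ℓ * (τ k).C) (dPrime (τ k) ℓ) ρ S ∧
      ∀ i < k, ρ < (τ i).U → Schedulable M τ i) : Schedulable M τ k := by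
  intro J exec H j
  by_contra hmiss
  obtain ⟨p, hpj, hbusy⟩ := JobSequence.exists_busyFrom (not_le.1 hmiss)
  obtain ⟨n, rfl⟩ := Nat.exists_eq_add_of_le hpj
  obtain ⟨ρ, S, htest, hdl⟩ := h (n + 1) n.succ_pos
  exact hmiss (H.meetsDeadline_of_busyFrom hM htest (fun i hi hU => hdl i hi hU J exec H) hbusy)

theorem schedulable_of_utilizationTest_of_D_le_T {N M : ℕ} {τ : Fin N → SporadicTask} {k : Fin N}
    {ρ : ℝ} {S : Finset (Fin N)} (hM : 1 ≤ M) (hDT : (τ k).D ≤ (τ k).T)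
    (htest : UtilizationTest M τ k (τ k).C (τ k).D ρ S)
    (hdl : ∀ i < k, ρ < (τ i).U → Schedulable M τ i) : Schedulable M τ k := by
  intro J exec H j
  induction j using Nat.strong_induction_on with
  | _ j ih =>
    by_contra hmiss
    have hfinished : ∀ j' < j, J.cost k j' ≤ JobSequence.service exec k j' (J.arr k j) := by
      intro j' hj'
      refine (ih j' hj').trans (JobSequence.service_mono exec k j' ?_)
      calc J.arr k j' + (τ k).D ≤ J.arr k j' + (τ k).T := by gcongr
        _ ≤ J.arr k (j' + 1) := J.arr_sep k j'
        _ ≤ J.arr k j := (J.arr_strictMono k).monotone hj'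
    have hbusy := JobSequence.busyFrom_of_service_lt (not_le.1 hmiss) hfinished
    exact hmiss (H.meetsDeadline_of_busyFrom (n := 0) hM (by simpa [dPrime] using htest)
      (fun i hi hU => hdl i hi hU J exec H) hbusy)

theorem theorem4p4_general {N : ℕ} (M : ℕ) (hM : 1 ≤ M) (τ : Fin N → SporadicTask) (k : Fin N) :
    ((∀ ℓ : ℕ, 1 ≤ ℓ →
        ∃ ρ S, UtilizationTest M τ k (ℓ * (τ k).C) (dPrime (τ k) ℓ) ρ S ∧
          ∀ i < k, ρ < (τ i).U → Schedulable M τ i) →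
      Schedulable M τ k) ∧
    ((τ k).D ≤ (τ k).T →
      (∃ ρ S, UtilizationTest M τ k (τ k).C (τ k).D ρ S ∧
          ∀ i < k, ρ < (τ i).U → Schedulable M τ i) →
      Schedulable M τ k) :=
  ⟨schedulable_of_utilizationTest hM, fun hDT ⟨_, _, htest, hdl⟩ =>
    schedulable_of_utilizationTest_of_D_le_T hM hDT htest hdl⟩

theorem theorem4p4 {N : ℕ} (M : ℕ) (hM : 2 ≤ M) (τ : Fin N → SporadicTask) (k : Fin N)
    (hhp : ∀ i < k, Schedulable M τ i) :
    ((∀ ℓ : ℕ, 1 ≤ ℓ →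
        ∃ ρ : ℝ, (ℓ : ℝ) * (τ k).C / dPrime (τ k) ℓ ≤ ρ ∧ ρ ≤ 1 ∧
          ∃ S : Finset (Fin N), IsCarryApprox M τ k ρ S ∧
            (ℓ : ℝ) * (τ k).C / dPrime (τ k) ℓ
              + ∑ i ∈ S, gammaVal (τ i) ρ * (τ i).U * (τ i).D / dPrime (τ k) ℓ
              + ∑ i ∈ Finset.Iio k,
                  (((τ i).C - (τ i).C * (τ i).U) / dPrime (τ k) ℓ + (τ i).U)
              ≤ muVal M ρ) →
      Schedulable M τ k) ∧
    ((τ k).D ≤ (τ k).T →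
      (∃ ρ : ℝ, (τ k).C / (τ k).D ≤ ρ ∧ ρ ≤ 1 ∧
          ∃ S : Finset (Fin N), IsCarryApprox M τ k ρ S ∧
            (τ k).C / (τ k).D
              + ∑ i ∈ S, gammaVal (τ i) ρ * (τ i).U * (τ i).D / (τ k).D
              + ∑ i ∈ Finset.Iio k,
                  (((τ i).C - (τ i).C * (τ i).U) / (τ k).D + (τ i).U)
              ≤ muVal M ρ) →
      Schedulable M τ k) := by
  exact (theorem4p4_general M (one_le_two.trans hM) τ k).imp
    (fun h htest => h fun ℓ hℓ => (htest ℓ hℓ).imp fun _ ⟨hρ, _, S, hS, hle⟩ =>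
      ⟨S, ⟨hρ, hS, hle⟩, fun i hi _ => hhp i hi⟩)
    fun h hDT htest => h hDT (htest.imp fun _ ⟨hρ, _, S, hS, hle⟩ =>
      ⟨S, ⟨hρ, hS, hle⟩, fun i hi _ => hhp i hi⟩)
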